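/- For $x\in\mathbb{R}$ let $\phi(x)=\operatorname{dist}(x,\mathbb{Z})$ denote the distance from $x$ to the nearest integer, and for each integer $r\ge 2$ let $$f_r(x)=\sum_{n=0}^\infty r^{-n}\phi(r^n x),\qquad x\in\mathbb{R},$$ be the Takagi–van der Waerden function. Let $\lambda$ denote Lebesgue measure on $\mathbb{R}$. Then for every integer $r\ge 2$ the occupation measure $\mu_{f_r}$ of $f_r$, defined by $$\mu_{f_r}(A)=\lambda\{x\in[0,1): f_r(x)\in A\}\qquad\text{for Borel sets } A\subseteq\mathbb{R},$$ is singular with respect to $\lambda$; that is, there is a Borel set $B\subseteq\mathbb{R}$ with $\mu_{f_r}(B)=0$ and $\lambda(\mathbb{R}\setminus B)=0$. -/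

import Mathlib

open MeasureTheory

/-- The distance from a real number to the nearest integer. -/
noncomputable def distInt (x : ℝ) : ℝ :=
  Metric.infDist x (Set.range ((↑) : ℤ → ℝ))

/-- The Takagi-van der Waerden function `f_r(x) = ∑_{n ≥ 0} r^{-n} φ(r^n x)`, where `φ` is the
distance to the nearest integer. -/
noncomputable def takagiVdW (r : ℕ) (x : ℝ) : ℝ :=
  ∑' n : ℕ, ((r : ℝ) ^ n)⁻¹ * distInt ((r : ℝ) ^ n * x)

/-- The occupation measure on `[0,1)` of a function `f`: the Borel measure
`A ↦ λ {x ∈ [0,1) : f x ∈ A}`, that is, the image under `f` of Lebesgue measure on `[0,1)`. -/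
noncomputable def occupationMeasure (f : ℝ → ℝ) : Measure ℝ :=
  (volume.restrict (Set.Ico (0 : ℝ) 1)).map f

theorem distInt_eq_abs_sub_round (x : ℝ) : distInt x = |x - round x| := by
  unfold distInt
  apply le_antisymm
  · simpa [Real.dist_eq] using
      Metric.infDist_le_dist_of_mem (x := x) (Set.mem_range_self (f := ((↑) : ℤ → ℝ)) (round x))
  · rw [Metric.le_infDist (Set.range_nonempty _)]
    rintro _ ⟨m, rfl⟩
    simpa [Real.dist_eq] using round_le x m

theorem continuous_distInt : Continuous distInt :=
  Metric.continuous_infDist_pt _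

theorem norm_takagiVdW_term_le (r n : ℕ) (x : ℝ) :
    ‖((r : ℝ) ^ n)⁻¹ * distInt ((r : ℝ) ^ n * x)‖ ≤ ((r : ℝ)⁻¹) ^ n := by
  have h : |distInt ((r : ℝ) ^ n * x)| ≤ 1 := by
    rw [distInt_eq_abs_sub_round, abs_abs]
    linarith [abs_sub_round ((r : ℝ) ^ n * x)]
  rw [Real.norm_eq_abs, abs_mul, inv_pow, abs_of_nonneg (by positivity : 0 ≤ ((r : ℝ) ^ n)⁻¹)]
  exact mul_le_of_le_one_right (by positivity) h

theorem summable_inv_natCast_pow {r : ℕ} (hr : 2 ≤ r) :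
    Summable fun n : ℕ => ((r : ℝ)⁻¹) ^ n :=
  summable_geometric_of_lt_one (by positivity)
    (inv_lt_one_of_one_lt₀ (by exact_mod_cast (show 1 < r by omega)))

/-- The defining series converges. -/
theorem hasSum_takagiVdW {r : ℕ} (hr : 2 ≤ r) (x : ℝ) :
    HasSum (fun n : ℕ => ((r : ℝ) ^ n)⁻¹ * distInt ((r : ℝ) ^ n * x)) (takagiVdW r x) :=
  (Summable.of_norm_bounded (summable_inv_natCast_pow hr)
    fun n => norm_takagiVdW_term_le r n x).hasSum

theorem continuous_takagiVdW {r : ℕ} (hr : 2 ≤ r) : Continuous (takagiVdW r) :=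
  continuous_tsum
    (fun _ => continuous_const.mul (continuous_distInt.comp (continuous_const.mul continuous_id)))
    (summable_inv_natCast_pow hr) (fun n x => norm_takagiVdW_term_le r n x)

/-- The occupation measure of `f_r` satisfies its defining formula on all Borel sets. -/
theorem occupationMeasure_takagiVdW_apply {r : ℕ} (hr : 2 ≤ r) {A : Set ℝ}
    (hA : MeasurableSet A) :
    occupationMeasure (takagiVdW r) A = volume {x ∈ Set.Ico (0 : ℝ) 1 | takagiVdW r x ∈ A} := by
  have hm := (continuous_takagiVdW hr).measurable
  rw [occupationMeasure, Measure.map_apply hm hA, Measure.restrict_apply (hm hA),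
    Set.inter_comm]
  rfl

/-! Let `μ` be the occupation measure of `f = takagiVdW r` and `g` the density of its absolutely
continuous part. The graph is self-affine: `f x = takagiPartial r m x + r⁻ᵐ f (rᵐ x)`. If the slope
of the partial sum vanishes at `x`, that sum equals a constant `c` on a cell around `x` long enough
for `rᵐ x` to run through a full period. The symmetry `x ↦ 1 - x` yields a second, disjoint such
cell, so `μ (c + r⁻ᵐ B) ≥ 2 r⁻ᵐ μ B` for every ball `B` (`two_mul_occupationMeasure_le`).

For almost every `x` this happens for infinitely many `m` (`ae_frequently_slope_eq_zero`): the
slopes form an odd ±1 cocycle over the ergodic map `z ↦ r • z`, and it is unbounded in both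
directions.

At a Lebesgue differentiation point `y = f x`, letting `m → ∞` gives `2 μ B / λ B ≤ g y` for balls
`B` centred at `y`. Shrinking `B` gives `2 g y ≤ g y`, so `g y = 0` once `g y` is finite. -/

/-! ### Singularity from doubled self-similar copies -/

/-- If around almost every value of `f` the image measure `ρ.map f` contains, at arbitrarily small
scales, rescaled copies of twice itself, then it is singular. -/
theorem mutuallySingular_map_of_frequently_two_mul_le {α : Type*} [MeasurableSpace α]
    {ρ : Measure α} [IsFiniteMeasure ρ] {f : α → ℝ} (hf : Measurable f) {s : ℕ → ℝ}
    (hs : Filter.Tendsto s Filter.atTop (nhdsWithin 0 (Set.Ioi 0)))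
    (h : ∀ᵐ x ∂ρ, ∃ᶠ n in Filter.atTop, ∃ c, |f x - c| ≤ s n ∧ ∀ z δ : ℝ,
      ENNReal.ofReal (s n) * (2 * ρ.map f (Metric.closedBall z δ)) ≤
        ρ.map f (Metric.closedBall (c + s n * z) (s n * δ))) :
    Measure.MutuallySingular (ρ.map f) volume := by
  set μ := ρ.map f with hμ
  set g := μ.rnDeriv volume with hg
  have hgm : Measurable g := Measure.measurable_rnDeriv _ _
  have hspos : ∀ᶠ n in Filter.atTop, 0 < s n := hs.eventually self_mem_nhdsWithin
  have generic : ∀ᵐ y ∂(volume : Measure ℝ), g y < ⊤ ∧ ∀ K : ℕ, Filter.Tendsto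
      (fun a => μ a / volume a)
      ((IsUnifLocDoublingMeasure.vitaliFamily (volume : Measure ℝ) K).filterAt y)
      (nhds (g y)) :=
    (Measure.rnDeriv_lt_top μ volume).and
      (ae_all_iff.2 fun K => VitaliFamily.ae_tendsto_rnDeriv _ _)
  have key : ∀ y, g y < ⊤ → (∀ K : ℕ, Filter.Tendsto (fun a => μ a / volume a)
      ((IsUnifLocDoublingMeasure.vitaliFamily (volume : Measure ℝ) K).filterAt y)
      (nhds (g y))) →
      (∃ᶠ n in Filter.atTop, ∃ c, |y - c| ≤ s n ∧ ∀ z δ : ℝ,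
        ENNReal.ofReal (s n) * (2 * μ (Metric.closedBall z δ)) ≤
          μ (Metric.closedBall (c + s n * z) (s n * δ))) → g y = 0 := by
    intro y hy hlim hfreq
    have ball_le : ∀ δ : ℝ, 0 < δ →
        2 * (μ (Metric.closedBall y δ) / volume (Metric.closedBall y δ)) ≤ g y := by
      intro δ hδ
      choose! c hc using fun n (hn : ∃ c, |y - c| ≤ s n ∧ ∀ z δ : ℝ,
        ENNReal.ofReal (s n) * (2 * μ (Metric.closedBall z δ)) ≤
          μ (Metric.closedBall (c + s n * z) (s n * δ))) => hn
      let P : ℕ → Prop := fun n => |y - c n| ≤ s n ∧ ∀ z δ : ℝ,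
        ENNReal.ofReal (s n) * (2 * μ (Metric.closedBall z δ)) ≤
          μ (Metric.closedBall (c n + s n * z) (s n * δ))
      have hP : ∃ᶠ n in Filter.atTop, P n := hfreq.mono hc
      let l : Filter ℕ := Filter.atTop ⊓ Filter.principal {n | P n}
      have : l.NeBot := Filter.frequently_mem_iff_neBot.1 hP
      -- The scaled balls are centred at `c n + s n * y`, not at `y`. Their distance from `y` is at
      -- most `s n * (1 + |y|)`, hence at most `K` radii, with `K` independent of `n`.
      obtain ⟨K, hK⟩ := exists_nat_ge ((1 + |y|) / δ)
      have hl : l ≤ Filter.atTop := inf_le_left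
      have hPl : ∀ᶠ n in l, P n := Filter.mem_inf_of_right (Filter.mem_principal_self _)
      have hsl : ∀ᶠ n in l, 0 < s n := hl hspos
      have hδlim : Filter.Tendsto (fun n => s n * δ) l (nhdsWithin 0 (Set.Ioi 0)) := by
        rw [tendsto_nhdsWithin_iff]
        refine ⟨?_, ?_⟩
        · simpa using ((tendsto_nhdsWithin_iff.1 hs).1.mono_left hl).mul_const δ
        · filter_upwards [hsl] with n hn
          exact mul_pos hn hδ
      have hmem : ∀ᶠ n in l, y ∈ Metric.closedBall (c n + s n * y) ((K : ℝ) * (s n * δ)) := by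
        filter_upwards [hPl, hsl] with n hn hpos
        rw [Metric.mem_closedBall, Real.dist_eq]
        have h1 : |y - (c n + s n * y)| ≤ |y - c n| + |s n * y| := by
          rw [← sub_sub]; exact abs_sub _ _
        rw [abs_mul, abs_of_pos hpos] at h1
        have h2 : 1 + |y| ≤ K * δ := (div_le_iff₀ hδ).1 hK
        nlinarith [hn.1, mul_le_mul_of_nonneg_left h2 hpos.le]
      have hT := (hlim K).comp (IsUnifLocDoublingMeasure.tendsto_closedBall_filterAt
        (μ := (volume : Measure ℝ)) _ _ hδlim hmem)
      refine ge_of_tendsto hT ?_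
      filter_upwards [hPl, hsl] with n hn hpos
      have h0 := hn.2 y δ
      simp only [Function.comp, Real.volume_closedBall]
      have h1 : ENNReal.ofReal (2 * (s n * δ)) =
          ENNReal.ofReal (s n) * ENNReal.ofReal (2 * δ) := by
        rw [← ENNReal.ofReal_mul hpos.le]; congr 1; ring
      rw [h1, ← mul_div_assoc]
      have hne : ENNReal.ofReal (s n) ≠ 0 := by simpa using hpos
      rw [← ENNReal.mul_div_mul_left _ _ hne ENNReal.ofReal_ne_top]
      gcongr
    have hT := (hlim 1).comp (IsUnifLocDoublingMeasure.tendsto_closedBall_filterAt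
        (μ := (volume : Measure ℝ)) (K := ((1 : ℕ) : ℝ)) (x := y) (fun _ : ℝ => y) id
        (Filter.tendsto_id (α := ℝ)) (by
          filter_upwards [self_mem_nhdsWithin] with δ hδ
          have : (0 : ℝ) ≤ δ := le_of_lt hδ
          simpa using this))
    have h2 : 2 * g y ≤ g y := by
      refine le_of_tendsto (ENNReal.Tendsto.const_mul hT (Or.inr (by simp))) ?_
      filter_upwards [self_mem_nhdsWithin] with δ hδ using ball_le δ hδ
    by_contra hne
    have : g y + g y ≤ g y + 0 := by rwa [add_zero, ← two_mul]
    exact hne (le_zero_iff.1 ((ENNReal.add_le_add_iff_left hy.ne).1 this))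
  -- A measurable null hull of the nongeneric points makes `B` Borel. The set `B` is `μ`-null by
  -- `key`, so `g` integrates to zero over it although `g` is nonzero there.
  set N := toMeasurable volume {y | ¬(g y < ⊤ ∧ ∀ K : ℕ, Filter.Tendsto
      (fun a => μ a / volume a)
      ((IsUnifLocDoublingMeasure.vitaliFamily (volume : Measure ℝ) K).filterAt y)
      (nhds (g y)))} with hN
  have hN0 : volume N = 0 := by rw [hN, measure_toMeasurable]; exact generic
  have hNm : MeasurableSet N := measurableSet_toMeasurable _ _
  set B : Set ℝ := Nᶜ ∩ {y | g y = 0}ᶜ with hB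
  have hBm : MeasurableSet B := hNm.compl.inter (hgm (measurableSet_singleton 0)).compl
  have hμB : μ B = 0 := by
    rw [hμ, Measure.map_apply hf hBm]
    refine measure_mono_null ?_ h
    intro x hx hx'
    have hgen := not_not.1 fun hcon => hx.1 (subset_toMeasurable _ _ hcon)
    exact hx.2 (key _ hgen.1 hgen.2 hx')
  have hB0 : ∫⁻ y in B, g y = 0 := by
    rw [← withDensity_apply _ hBm]
    exact le_zero_iff.1 (hμB ▸ Measure.withDensity_rnDeriv_le μ volume B)
  rw [lintegral_eq_zero_iff hgm, Filter.EventuallyEq, ae_restrict_iff' hBm] at hB0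
  rw [← Measure.rnDeriv_eq_zero]
  filter_upwards [hB0, compl_mem_ae_iff.2 hN0] with y hy hyN
  by_contra hne
  exact hne (hy ⟨hyN, hne⟩)

/-! ### Recurrence of the slope cocycle -/

/-- The right derivative of the distance to the nearest integer. -/
noncomputable def slopeSign (x : ℝ) : ℤ := if Int.fract x < 1 / 2 then 1 else -1

/-- `slopeSign` as a function on the circle `ℝ / ℤ`. -/
noncomputable def circleSign (z : UnitAddCircle) : ℤ :=
  slopeSign (AddCircle.equivIco 1 0 z)

theorem circleSign_coe (x : ℝ) : circleSign (x : UnitAddCircle) = slopeSign x := by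
  have h : ((AddCircle.equivIco 1 0 (x : UnitAddCircle) : Set.Ico (0 : ℝ) (0 + 1)) : ℝ)
      = Int.fract x := by
    simp [AddCircle.coe_equivIco_mk_apply (p := (1 : ℝ)) x]
  rw [circleSign, h, slopeSign, Int.fract_fract, slopeSign]

theorem measurable_circleSign : Measurable circleSign := by
  have h : Measurable slopeSign :=
    Measurable.ite (measurableSet_lt measurable_fract measurable_const) measurable_const
      measurable_const
  exact h.comp (measurable_subtype_coe.comp (AddCircle.measurableEquivIco 1 0).measurable)

theorem circleSign_eq_or (z : UnitAddCircle) : circleSign z = 1 ∨ circleSign z = -1 := by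
  unfold circleSign slopeSign; split_ifs <;> simp

theorem circleSign_neg {z : UnitAddCircle} (h0 : z ≠ ((0 : ℝ) : UnitAddCircle))
    (h1 : z ≠ ((1 / 2 : ℝ) : UnitAddCircle)) : circleSign (-z) = -circleSign z := by
  induction z using QuotientAddGroup.induction_on with
  | H x =>
    change circleSign ((-x : ℝ) : UnitAddCircle) = -circleSign (x : UnitAddCircle)
    have hfr : ((Int.fract x : ℝ) : UnitAddCircle) = x := by
      have : (x : UnitAddCircle) = ((Int.fract x + ⌊x⌋ : ℝ) : UnitAddCircle) := by
        rw [Int.fract_add_floor]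
      rw [this, AddCircle.coe_add]
      simp
    have h0' : Int.fract x ≠ 0 := fun h => h0 (by rw [← h]; exact hfr.symm)
    have h1' : Int.fract x ≠ 1 / 2 := fun h => h1 (by rw [← h]; exact hfr.symm)
    rw [circleSign_coe, circleSign_coe, slopeSign, slopeSign, Int.fract_neg h0']
    rcases lt_or_gt_of_ne h1' with h | h
    · rw [if_neg (by linarith), if_pos h]
    · rw [if_pos (by linarith), if_neg (by linarith), neg_neg]

/-- The cocycle of slopes of the partial sums of the Takagi-van der Waerden series. -/
noncomputable def circleSlope (r n : ℕ) (z : UnitAddCircle) : ℤ :=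
  ∑ k ∈ Finset.range n, circleSign (r ^ k • z)

theorem measurable_circleSlope (r n : ℕ) : Measurable (circleSlope r n) :=
  Finset.measurable_sum _ fun k _ =>
    measurable_circleSign.comp (continuous_nsmul (r ^ k)).measurable

theorem circleSlope_succ (r n : ℕ) (z : UnitAddCircle) :
    circleSlope r (n + 1) z = circleSlope r n z + circleSign (r ^ n • z) :=
  Finset.sum_range_succ _ _

theorem circleSlope_add (r m n : ℕ) (z : UnitAddCircle) :
    circleSlope r (m + n) z = circleSlope r m z + circleSlope r n (r ^ m • z) := by
  simp only [circleSlope, Finset.sum_range_add, pow_add, mul_nsmul]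

theorem unitAddCircle_ae_ne (a : UnitAddCircle) : ∀ᵐ z : UnitAddCircle, z ≠ a := by
  have h : volume ({a} : Set UnitAddCircle) = 0 := by
    rw [← Metric.closedBall_zero, AddCircle.volume_closedBall]
    simp
  exact measure_eq_zero_iff_ae_notMem.1 h

theorem measurePreserving_pow_nsmul {r : ℕ} (hr : 2 ≤ r) (k : ℕ) :
    MeasurePreserving (fun z : UnitAddCircle => r ^ k • z) volume volume := by
  have h : Ergodic (fun z : UnitAddCircle => r • z) volume := AddCircle.ergodic_nsmul (by omega)
  have := h.toMeasurePreserving.iterate k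
  rwa [smul_iterate] at this

theorem ae_circleSlope_neg {r : ℕ} (hr : 2 ≤ r) :
    ∀ᵐ z : UnitAddCircle, ∀ n, circleSlope r n (-z) = -circleSlope r n z := by
  have h : ∀ k : ℕ, ∀ᵐ z : UnitAddCircle,
      r ^ k • z ≠ ((0 : ℝ) : UnitAddCircle) ∧ r ^ k • z ≠ ((1 / 2 : ℝ) : UnitAddCircle) := by
    intro k
    have h' := (measurePreserving_pow_nsmul hr k).quasiMeasurePreserving.ae
      ((unitAddCircle_ae_ne ((0 : ℝ) : UnitAddCircle)).and
        (unitAddCircle_ae_ne ((1 / 2 : ℝ) : UnitAddCircle)))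
    exact h'
  filter_upwards [ae_all_iff.2 h] with z hz n
  simp only [circleSlope, ← Finset.sum_neg_distrib]
  exact Finset.sum_congr rfl fun k _ => by rw [smul_neg, circleSign_neg (hz k).1 (hz k).2]

theorem ae_exists_nsmul_mem {r : ℕ} (hr : 2 ≤ r) {A : Set UnitAddCircle} (hA : MeasurableSet A)
    (hA0 : volume A ≠ 0) : ∀ᵐ z : UnitAddCircle, ∃ k : ℕ, r ^ k • z ∈ A := by
  have herg : Ergodic (fun z : UnitAddCircle => r • z) volume := AddCircle.ergodic_nsmul (by omega)
  set C : Set UnitAddCircle := ⋃ k : ℕ, (fun z => r ^ k • z) ⁻¹' A with hC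
  have hCm : MeasurableSet C :=
    MeasurableSet.iUnion fun k => (continuous_nsmul (r ^ k)).measurable hA
  have hsub : (fun z : UnitAddCircle => r • z) ⁻¹' C ⊆ C := by
    intro z hz
    obtain ⟨k, hk⟩ := Set.mem_iUnion.1 hz
    refine Set.mem_iUnion.2 ⟨k + 1, ?_⟩
    simpa only [Set.mem_preimage, pow_succ', mul_nsmul] using hk
  rcases herg.ae_empty_or_univ_of_preimage_ae_le hCm.nullMeasurableSet
    (Filter.Eventually.of_forall hsub) with h | h
  · refine absurd (measure_mono_null (fun z hz => ?_) (ae_eq_empty.1 h)) hA0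
    exact Set.mem_iUnion.2 ⟨0, by simpa using hz⟩
  · filter_upwards [h] with z hz
    have : z ∈ C := hz.mpr trivial
    simpa [hC] using this

theorem circleSlope_coe (r n : ℕ) (x : ℝ) :
    circleSlope r n (x : UnitAddCircle) = ∑ k ∈ Finset.range n, slopeSign ((r : ℝ) ^ k * x) := by
  refine Finset.sum_congr rfl fun k _ => ?_
  rw [← circleSign_coe, ← AddCircle.coe_nsmul, nsmul_eq_mul, Nat.cast_pow]

/-- Just to the right of `0` the first `M` iterates all stay in `[0, 1/2)`, so every sign is `+1`;
by ergodicity almost every orbit enters that interval. -/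
theorem ae_exists_circleSlope_eq {r : ℕ} (hr : 2 ≤ r) (M : ℕ) :
    ∀ᵐ z : UnitAddCircle, ∃ k : ℕ, circleSlope r M (r ^ k • z) = M := by
  refine ae_exists_nsmul_mem hr (A := {z | circleSlope r M z = M})
    (measurable_circleSlope r M (measurableSet_singleton _)) ?_
  have hm : MeasurableSet {z | circleSlope r M z = M} :=
    measurable_circleSlope r M (measurableSet_singleton _)
  rw [← (UnitAddCircle.measurePreserving_mk 0).measure_preimage hm.nullMeasurableSet]
  have hr1 : (1 : ℝ) ≤ r := by exact_mod_cast (by omega : 1 ≤ r)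
  have hp : (0 : ℝ) < (r : ℝ) ^ M := by positivity
  have hsub : Set.Ioo (0 : ℝ) (1 / (2 * (r : ℝ) ^ M)) ⊆
      ((↑) : ℝ → UnitAddCircle) ⁻¹' {z | circleSlope r M z = M} := by
    intro x hx
    change circleSlope r M (x : UnitAddCircle) = M
    rw [circleSlope_coe, Finset.sum_congr rfl (g := fun _ => (1 : ℤ)), Finset.sum_const,
      Finset.card_range, nsmul_one]
    intro k hk
    have h1 : (r : ℝ) ^ k ≤ (r : ℝ) ^ M := pow_le_pow_right₀ hr1 (Finset.mem_range.1 hk).le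
    have h2 : x * (2 * (r : ℝ) ^ M) < 1 := (lt_div_iff₀ (by positivity)).1 hx.2
    have h3 : (r : ℝ) ^ k * x < 1 / 2 := by nlinarith [hx.1]
    have h4 : 0 ≤ (r : ℝ) ^ k * x := mul_nonneg (by positivity) hx.1.le
    rw [slopeSign, if_pos]
    rwa [Int.fract_eq_self.2 ⟨h4, by linarith⟩]
  refine ne_of_gt (lt_of_lt_of_le ?_ (measure_mono hsub))
  rw [Measure.restrict_apply measurableSet_Ioo, Set.inter_eq_left.2]
  · simp [hp]
  · intro x hx
    have h2 : x * (2 * (r : ℝ) ^ M) < 1 := (lt_div_iff₀ (by positivity)).1 hx.2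
    have : (1 : ℝ) ≤ (r : ℝ) ^ M := one_le_pow₀ hr1
    exact ⟨hx.1, by nlinarith [hx.1]⟩

/-- By ergodicity the event is null or conull. Were it null, oddness would bound the cocycle on both
sides almost everywhere, which arbitrarily long runs of `+1` forbid. -/
theorem ae_circleSlope_unbounded_above {r : ℕ} (hr : 2 ≤ r) :
    ∀ᵐ z : UnitAddCircle, ∀ K : ℤ, ∃ n, K ≤ circleSlope r n z := by
  have herg : Ergodic (fun z : UnitAddCircle => r • z) volume := AddCircle.ergodic_nsmul (by omega)
  set U : Set UnitAddCircle := {z | ∀ K : ℤ, ∃ n, K ≤ circleSlope r n z} with hU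
  have hUm : MeasurableSet U := by
    have : U = ⋂ K : ℤ, ⋃ n, {z | K ≤ circleSlope r n z} := by ext z; simp [hU]
    rw [this]
    exact MeasurableSet.iInter fun K => MeasurableSet.iUnion fun n =>
      measurableSet_le measurable_const (measurable_circleSlope r n)
  have hsub : (fun z : UnitAddCircle => r • z) ⁻¹' U ⊆ U := by
    intro z hz K
    obtain ⟨n, hn⟩ := hz (K + 1)
    refine ⟨1 + n, ?_⟩
    rw [circleSlope_add, pow_one]
    have h1 : circleSlope r 1 z = circleSign z := by simp [circleSlope]
    change K + 1 ≤ circleSlope r n (r • z) at hn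
    rcases circleSign_eq_or z with h | h <;> omega
  rcases herg.ae_empty_or_univ_of_preimage_ae_le hUm.nullMeasurableSet
    (Filter.Eventually.of_forall hsub) with h | h
  · exfalso
    have hae : ∀ᵐ z : UnitAddCircle, z ∉ U := measure_eq_zero_iff_ae_notMem.1 (ae_eq_empty.1 h)
    have hneg := (Measure.measurePreserving_neg
      (volume : Measure UnitAddCircle)).quasiMeasurePreserving.ae hae
    have hfalse : ∀ᵐ z : UnitAddCircle, False := by
      filter_upwards [hae, hneg, ae_circleSlope_neg hr,
        ae_all_iff.2 (ae_exists_circleSlope_eq hr)] with z h1 h2 h3 h4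
      simp only [hU, Set.mem_ofPred_eq, not_forall, not_exists, not_le, h3] at h1 h2
      obtain ⟨K, hK⟩ := h1
      obtain ⟨K', hK'⟩ := h2
      -- A run of `K + K'` rises starting above `-K'` ends above `K`.
      obtain ⟨k, hk⟩ := h4 (K + K').toNat
      have := circleSlope_add r k (K + K').toNat z
      have := hK (k + (K + K').toNat)
      have := hK' k
      omega
    have huniv := UnitAddCircle.measure_univ
    have hzero : (volume : Measure UnitAddCircle) = 0 := by simpa using hfalse
    simp [hzero] at huniv
  · filter_upwards [h] with z hz
    exact hz.mpr trivial

theorem ae_circleSlope_unbounded_below {r : ℕ} (hr : 2 ≤ r) :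
    ∀ᵐ z : UnitAddCircle, ∀ K : ℤ, ∃ n, circleSlope r n z ≤ K := by
  have hneg := (Measure.measurePreserving_neg
    (volume : Measure UnitAddCircle)).quasiMeasurePreserving.ae (ae_circleSlope_unbounded_above hr)
  filter_upwards [hneg, ae_circleSlope_neg hr] with z h1 h2 K
  obtain ⟨n, hn⟩ := h1 (-K)
  rw [h2] at hn
  exact ⟨n, by omega⟩

theorem exists_ge_of_unbounded {a : ℕ → ℤ} (h : ∀ K, ∃ n, K ≤ a n) (N : ℕ) (K : ℤ) :
    ∃ n ≥ N, K ≤ a n := by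
  by_contra! hcon
  obtain ⟨n, hn⟩ := h (K + ∑ i ∈ Finset.range N, |a i|)
  have hs : 0 ≤ ∑ i ∈ Finset.range N, |a i| := Finset.sum_nonneg fun i _ => abs_nonneg _
  rcases lt_or_ge n N with hnN | hnN
  · obtain ⟨m, hm⟩ := h (|K| + 1 + ∑ i ∈ Finset.range N, |a i|)
    rcases lt_or_ge m N with hmN | hmN
    · have := Finset.single_le_sum (f := fun i => |a i|) (fun i _ => abs_nonneg _)
        (Finset.mem_range.2 hmN)
      have := le_abs_self (a m)
      have := abs_nonneg K
      omega
    · have := hcon m hmN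
      have := le_abs_self K
      omega
  · have := hcon n hnN
    omega

theorem frequently_eq_zero_of_unbounded {a : ℕ → ℤ} (hstep : ∀ n, |a (n + 1) - a n| ≤ 1)
    (hup : ∀ K, ∃ n, K ≤ a n) (hdown : ∀ K, ∃ n, a n ≤ K) :
    ∃ᶠ n in Filter.atTop, a n = 0 := by
  rw [Filter.frequently_atTop]
  intro N
  obtain ⟨n, hnN, hn⟩ := exists_ge_of_unbounded hup N 0
  obtain ⟨m, hmn, hm⟩ := exists_ge_of_unbounded (a := fun n => -a n)
    (fun K => (hdown (-K)).imp fun n hn => by omega) n 0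
  -- At the first time from `n` on with a nonpositive value, the value is exactly `0`: steps of size
  -- at most one cannot jump over it.
  have hex : ∃ m, n ≤ m ∧ a m ≤ 0 := ⟨m, hmn, by simpa using hm⟩
  classical
  obtain ⟨h1, h2⟩ := Nat.find_spec hex
  refine ⟨Nat.find hex, by omega, ?_⟩
  rcases eq_or_lt_of_le h1 with h | h
  · rw [← h] at h2 ⊢; omega
  · obtain ⟨p, hp⟩ : ∃ p, Nat.find hex = p + 1 := ⟨Nat.find hex - 1, by omega⟩
    have h3 := Nat.find_min hex (m := p) (by omega)
    rw [hp] at h h2 ⊢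
    have h4 : 0 < a p := by
      by_contra hcon
      exact h3 ⟨by omega, by omega⟩
    have := abs_le.1 (hstep p)
    omega

/-- The slopes of the partial sums vanish infinitely often almost everywhere. -/
theorem ae_frequently_slope_eq_zero {r : ℕ} (hr : 2 ≤ r) :
    ∀ᵐ x ∂(volume.restrict (Set.Ico (0 : ℝ) 1)), ∃ᶠ n in Filter.atTop,
      ∑ k ∈ Finset.range n, slopeSign ((r : ℝ) ^ k * x) = 0 := by
  have h : ∀ᵐ z : UnitAddCircle, ∃ᶠ n in Filter.atTop, circleSlope r n z = 0 := by
    filter_upwards [ae_circleSlope_unbounded_above hr, ae_circleSlope_unbounded_below hr]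
      with z h1 h2
    refine frequently_eq_zero_of_unbounded (fun n => ?_) h1 h2
    rw [circleSlope_succ, add_sub_cancel_left]
    rcases circleSign_eq_or (r ^ n • z) with h | h <;> simp [h]
  have h' := (UnitAddCircle.measurePreserving_mk 0).quasiMeasurePreserving.ae h
  rw [zero_add, ← Measure.restrict_congr_set Ico_ae_eq_Ioc] at h'
  filter_upwards [h'] with x hx
  exact hx.mono fun n hn => by rwa [circleSlope_coe] at hn

/-! ### Self-affinity of the Takagi–van der Waerden function -/

theorem distInt_eq_min (x : ℝ) : distInt x = min (Int.fract x) (1 - Int.fract x) := by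
  rw [distInt_eq_abs_sub_round, abs_sub_round_eq_min]

theorem distInt_nonneg (x : ℝ) : 0 ≤ distInt x := Metric.infDist_nonneg

theorem distInt_le_half (x : ℝ) : distInt x ≤ 1 / 2 := by
  rw [distInt_eq_abs_sub_round]; exact abs_sub_round x

theorem distInt_add_intCast (x : ℝ) (m : ℤ) : distInt (x + m) = distInt x := by
  rw [distInt_eq_min, distInt_eq_min, Int.fract_add_intCast]

theorem distInt_neg (x : ℝ) : distInt (-x) = distInt x := by
  by_cases h : Int.fract x = 0
  · rw [distInt_eq_min, distInt_eq_min, Int.fract_neg_eq_zero.2 h, h]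
  · rw [distInt_eq_min, distInt_eq_min, Int.fract_neg h, sub_sub_cancel, min_comm]

theorem distInt_sub_eq {u v : ℝ} (h : ⌊2 * u⌋ = ⌊2 * v⌋) :
    distInt u - distInt v = slopeSign v * (u - v) := by
  have hu1 := Int.floor_le u
  have hu2 := Int.lt_floor_add_one u
  have hv1 := Int.floor_le v
  have hv2 := Int.lt_floor_add_one v
  have key : ∀ w : ℝ, ⌊w⌋ = ⌊2 * w⌋ / 2 := fun w => by
    have := Int.floor_div_natCast (2 * w) 2
    rw [← Nat.cast_ofNat (R := ℤ), ← this]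
    congr 1; push_cast; ring
  have hfl : ⌊u⌋ = ⌊v⌋ := by rw [key u, key v, h]
  have hlt : Int.fract u < 1 / 2 ↔ Int.fract v < 1 / 2 := by
    have : ∀ w : ℝ, Int.fract w < 1 / 2 ↔ ⌊2 * w⌋ < 2 * ⌊w⌋ + 1 := fun w => by
      rw [Int.floor_lt, Int.fract]; push_cast
      constructor <;> intro h <;> linarith
    rw [this u, this v, hfl, h]
  rw [distInt_eq_min, distInt_eq_min, slopeSign]
  by_cases hv : Int.fract v < 1 / 2
  · have hu := hlt.2 hv
    rw [if_pos hv, min_eq_left (by linarith), min_eq_left (by linarith),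
      Int.fract, Int.fract, hfl]
    push_cast; ring
  · have hu : ¬ Int.fract u < 1 / 2 := fun h => hv (hlt.1 h)
    rw [if_neg hv, min_eq_right (by linarith), min_eq_right (by linarith), Int.fract,
      Int.fract, hfl]
    push_cast; ring

theorem takagiVdW_neg (r : ℕ) (x : ℝ) : takagiVdW r (-x) = takagiVdW r x := by
  simp only [takagiVdW, mul_neg, distInt_neg]

theorem takagiVdW_add_intCast (r : ℕ) (x : ℝ) (m : ℤ) :
    takagiVdW r (x + m) = takagiVdW r x := by
  unfold takagiVdW
  refine tsum_congr fun n => ?_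
  have : (r : ℝ) ^ n * (x + m) = (r : ℝ) ^ n * x + ((r ^ n * m : ℤ) : ℝ) := by push_cast; ring
  rw [this, distInt_add_intCast]

theorem takagiVdW_nonneg (r : ℕ) (x : ℝ) : 0 ≤ takagiVdW r x :=
  tsum_nonneg fun _ => mul_nonneg (by positivity) (distInt_nonneg _)

theorem takagiVdW_le_one {r : ℕ} (hr : 2 ≤ r) (x : ℝ) : takagiVdW r x ≤ 1 := by
  have hr' : (2 : ℝ) ≤ r := by exact_mod_cast hr
  have h := (hasSum_geometric_two).mul_left (1 / 2 : ℝ)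
  refine hasSum_le (fun n => ?_) (hasSum_takagiVdW hr x) (by simpa using h)
  rw [mul_comm (2⁻¹ : ℝ), ← one_div (2 : ℝ)]
  exact mul_le_mul (inv_anti₀ (by positivity) (pow_le_pow_left₀ (by norm_num) hr' n))
    (distInt_le_half _) (distInt_nonneg _) (by positivity)

/-- The partial sums of the Takagi-van der Waerden series. -/
noncomputable def takagiPartial (r n : ℕ) (x : ℝ) : ℝ :=
  ∑ k ∈ Finset.range n, ((r : ℝ) ^ k)⁻¹ * distInt ((r : ℝ) ^ k * x)

theorem takagiVdW_eq_partial_add {r : ℕ} (hr : 2 ≤ r) (n : ℕ) (x : ℝ) :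
    takagiVdW r x =
      takagiPartial r n x + ((r : ℝ) ^ n)⁻¹ * takagiVdW r ((r : ℝ) ^ n * x) := by
  rw [takagiVdW, ← (hasSum_takagiVdW hr x).summable.sum_add_tsum_nat_add n, takagiPartial,
    takagiVdW, ← tsum_mul_left]
  congr 1
  refine tsum_congr fun k => ?_
  rw [pow_add, mul_inv, mul_assoc, mul_assoc]
  rw [mul_left_comm]

/-- The cells cut out by the half-integers divided by `r ^ n` are nested as `n` grows, for odd `r`
too. -/
theorem floor_two_mul_pow_eq {r n k : ℕ} (hr : 2 ≤ r) (hk : k ≤ n) {x y : ℝ}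
    (h : ⌊2 * ((r : ℝ) ^ n * y)⌋ = ⌊2 * ((r : ℝ) ^ n * x)⌋) :
    ⌊2 * ((r : ℝ) ^ k * y)⌋ = ⌊2 * ((r : ℝ) ^ k * x)⌋ := by
  have hr0 : (r : ℝ) ≠ 0 := by exact_mod_cast (by omega : r ≠ 0)
  have key : ∀ w : ℝ, ⌊2 * ((r : ℝ) ^ k * w)⌋ =
      ⌊2 * ((r : ℝ) ^ n * w)⌋ / ((r ^ (n - k) : ℕ) : ℤ) := fun w => by
    rw [← Int.floor_div_natCast]
    congr 1
    obtain ⟨m, rfl⟩ := Nat.exists_eq_add_of_le hk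
    rw [Nat.add_sub_cancel_left]
    push_cast
    rw [pow_add]
    field_simp
  rw [key y, key x, h]

theorem takagiPartial_succ_eq {r n : ℕ} (hr : 2 ≤ r) {x y : ℝ}
    (hx : ∑ k ∈ Finset.range (n + 1), slopeSign ((r : ℝ) ^ k * x) = 0)
    (h : ⌊2 * ((r : ℝ) ^ n * y)⌋ = ⌊2 * ((r : ℝ) ^ n * x)⌋) :
    takagiPartial r (n + 1) y = takagiPartial r (n + 1) x := by
  have hr0 : (r : ℝ) ≠ 0 := by exact_mod_cast (by omega : r ≠ 0)
  rw [← sub_eq_zero, takagiPartial, takagiPartial, ← Finset.sum_sub_distrib]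
  have : ∀ k ∈ Finset.range (n + 1), ((r : ℝ) ^ k)⁻¹ * distInt ((r : ℝ) ^ k * y) -
      ((r : ℝ) ^ k)⁻¹ * distInt ((r : ℝ) ^ k * x) = slopeSign ((r : ℝ) ^ k * x) * (y - x) := by
    intro k hk
    rw [← mul_sub, distInt_sub_eq (floor_two_mul_pow_eq hr (Finset.mem_range_succ_iff.1 hk) h)]
    field_simp
  rw [Finset.sum_congr rfl this, ← Finset.sum_mul]
  rw [← Int.cast_sum, hx, Int.cast_zero, zero_mul]

/-! ### Two scaled copies of the occupation measure -/

theorem volume_takagiVdW_mem_Ioo {r : ℕ} (hr : 2 ≤ r) {A : Set ℝ} (hA : MeasurableSet A) (b : ℝ) :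
    volume ({u | takagiVdW r u ∈ A} ∩ Set.Ioo b (b + 1)) = occupationMeasure (takagiVdW r) A := by
  have hm : MeasurableSet {u | takagiVdW r u ∈ A} := (continuous_takagiVdW hr).measurable hA
  have hinv : ∀ g : AddSubgroup.zmultiples (1 : ℝ),
      (fun x : ℝ => g +ᵥ x) ⁻¹' {u | takagiVdW r u ∈ A} = {u | takagiVdW r u ∈ A} := by
    rintro ⟨_, m, rfl⟩
    ext x
    simp only [Set.mem_preimage, Set.mem_ofPred_eq, AddSubgroup.vadd_def, vadd_eq_add]
    rw [add_comm, show (m • (1 : ℝ)) = (m : ℝ) by simp, takagiVdW_add_intCast]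
  have h := (isAddFundamentalDomain_Ioc one_pos b).measure_set_eq
    (isAddFundamentalDomain_Ioc one_pos 0) (μ := volume) hm hinv
  rw [occupationMeasure_takagiVdW_apply hr hA]
  calc _ = volume ({u | takagiVdW r u ∈ A} ∩ Set.Ioc b (b + 1)) :=
        measure_congr ((ae_eq_refl _).inter Ioo_ae_eq_Ioc)
    _ = _ := h
    _ = volume ({u | takagiVdW r u ∈ A} ∩ Set.Ico 0 1) := by
        rw [zero_add]
        exact measure_congr ((ae_eq_refl _).inter Ico_ae_eq_Ioc.symm)
    _ = _ := by rw [Set.inter_comm]; rfl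

theorem two_mul_occupationMeasure_le {r n : ℕ} (hr : 2 ≤ r) {x : ℝ} (hx01 : x ∈ Set.Ico (0 : ℝ) 1)
    (hx : ∑ k ∈ Finset.range (n + 1), slopeSign ((r : ℝ) ^ k * x) = 0) (z δ : ℝ) :
    ENNReal.ofReal ((r : ℝ) ^ (n + 1))⁻¹ *
        (2 * occupationMeasure (takagiVdW r) (Metric.closedBall z δ)) ≤
      occupationMeasure (takagiVdW r)
        (Metric.closedBall (takagiPartial r (n + 1) x + ((r : ℝ) ^ (n + 1))⁻¹ * z)
          (((r : ℝ) ^ (n + 1))⁻¹ * δ)) := by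
  have hr' : (2 : ℝ) ≤ r := by exact_mod_cast hr
  set R : ℝ := (r : ℝ) ^ (n + 1) with hR
  set Q : ℝ := (r : ℝ) ^ n with hQ
  have hQ0 : 0 < Q := by positivity
  have hR0 : 0 < R := by positivity
  -- Here `2 ≤ r` is decisive: the cell of length `1 / (2 * Q)` has room for a full period `1 / R`
  -- of the remainder.
  have hRQ : 2 * Q ≤ R := by rw [hR, pow_succ, ← hQ]; nlinarith
  set c := takagiPartial r (n + 1) x
  set J := Metric.closedBall (c + R⁻¹ * z) (R⁻¹ * δ)
  set i : ℤ := ⌊2 * (Q * x)⌋ with hi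
  have hi0 : 0 ≤ i := Int.floor_nonneg.2 (by have := hx01.1; positivity)
  have hi1 : i + 1 ≤ 2 * (r : ℤ) ^ n := by
    have : i < 2 * (r : ℤ) ^ n := by
      rw [hi, Int.floor_lt]; push_cast; rw [← hQ]; nlinarith [hx01.2]
    omega
  have hi1' : (i : ℝ) + 1 ≤ 2 * Q := by rw [hQ]; exact_mod_cast hi1
  have hi0' : (0 : ℝ) ≤ i := by exact_mod_cast hi0
  have hcyl : ∀ y, R * y ∈ Set.Ioo (R * (i / (2 * Q))) (R * (i / (2 * Q)) + 1) →
      i < 2 * (Q * y) ∧ 2 * (Q * y) < i + 1 := by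
    intro y hy
    have e : R * (i / (2 * Q)) = R * i / (2 * Q) := by ring
    rw [e] at hy
    have h1 : R * i < R * y * (2 * Q) := (div_lt_iff₀ (by positivity)).1 hy.1
    have h2 : (R * y - 1) * (2 * Q) < R * i := (lt_div_iff₀ (by positivity)).1 (by linarith [hy.2])
    constructor
    · refine lt_of_mul_lt_mul_left ?_ hR0.le
      linarith
    · refine lt_of_mul_lt_mul_left ?_ hR0.le
      linarith
  set E : Set ℝ := (R * ·) ⁻¹' ({u | takagiVdW r u ∈ Metric.closedBall z δ} ∩
    Set.Ioo (R * (i / (2 * Q))) (R * (i / (2 * Q)) + 1)) with hE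
  have hEm : MeasurableSet E := (measurable_const_mul R)
    (((continuous_takagiVdW hr).measurable Metric.isClosed_closedBall.measurableSet).inter
      measurableSet_Ioo)
  have hEvol : volume E =
      ENNReal.ofReal R⁻¹ * occupationMeasure (takagiVdW r) (Metric.closedBall z δ) := by
    rw [hE, Real.volume_preimage_mul_left hR0.ne',
      volume_takagiVdW_mem_Ioo hr Metric.isClosed_closedBall.measurableSet,
      abs_of_pos (inv_pos.2 hR0)]
  have hEJ : ∀ y ∈ E, takagiVdW r y ∈ J := by
    rintro y ⟨hy1, hy2⟩
    have hfl : ⌊2 * (Q * y)⌋ = i := Int.floor_eq_iff.2 ⟨(hcyl y hy2).1.le, (hcyl y hy2).2⟩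
    rw [takagiVdW_eq_partial_add hr (n + 1) y, takagiPartial_succ_eq hr hx hfl]
    simp only [Set.mem_ofPred_eq, Metric.mem_closedBall, Real.dist_eq] at hy1
    rw [Metric.mem_closedBall, Real.dist_eq, add_sub_add_left_eq_sub, ← mul_sub, abs_mul,
      abs_of_pos (inv_pos.2 hR0)]
    exact mul_le_mul_of_nonneg_left hy1 (inv_pos.2 hR0).le
  have hE01 : ∀ y ∈ E, 0 < y ∧ y < 1 := by
    rintro y ⟨-, hy2⟩
    obtain ⟨h1, h2⟩ := hcyl y hy2
    constructor
    · by_contra hcon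
      nlinarith
    · by_contra hcon
      nlinarith
  have hdisj : Disjoint E ((fun y => 1 - y) ⁻¹' E) := by
    rw [Set.disjoint_left]
    rintro y ⟨-, hy⟩ ⟨-, hy'⟩
    obtain ⟨h1, h2⟩ := hcyl y hy
    obtain ⟨h3, h4⟩ := hcyl _ hy'
    -- If `y` and `1 - y` lay in the same open cell, adding their bounds would put the integer `r ^
    -- n` strictly between `i` and `i + 1`.
    have h5 : i < (r : ℤ) ^ n := by
      have : (i : ℝ) < Q := by linarith
      rw [hQ] at this; exact_mod_cast this
    have h6 : (r : ℤ) ^ n < i + 1 := by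
      have : Q < (i : ℝ) + 1 := by linarith
      rw [hQ] at this; exact_mod_cast this
    omega
  have hE'm : MeasurableSet ((fun y : ℝ => 1 - y) ⁻¹' E) := (measurable_const.sub measurable_id) hEm
  have hE'vol : volume ((fun y : ℝ => 1 - y) ⁻¹' E) = volume E :=
    (Measure.measurePreserving_sub_left (volume : Measure ℝ) 1).measure_preimage hEm.nullMeasurableSet
  rw [mul_left_comm, ← hEvol, two_mul]
  nth_rewrite 2 [← hE'vol]
  rw [← measure_union hdisj hE'm,
    occupationMeasure_takagiVdW_apply hr Metric.isClosed_closedBall.measurableSet]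
  refine measure_mono (Set.union_subset (fun y hy => ?_) (fun y hy => ?_))
  · exact ⟨⟨(hE01 y hy).1.le, (hE01 y hy).2⟩, hEJ y hy⟩
  · have h := hE01 _ hy
    refine ⟨⟨by linarith [h.2], by linarith [h.1]⟩, ?_⟩
    have := hEJ _ hy
    beta_reduce at this
    rwa [show (1 : ℝ) - y = -y + ((1 : ℤ) : ℝ) by push_cast; ring, takagiVdW_add_intCast,
      takagiVdW_neg] at this

theorem mainTheorem2 (r : ℕ) (hr : 2 ≤ r) :
    Measure.MutuallySingular (occupationMeasure (takagiVdW r)) (volume : Measure ℝ) := by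
  have hr1 : (1 : ℝ) < r := by exact_mod_cast (by omega : 1 < r)
  refine mutuallySingular_map_of_frequently_two_mul_le (continuous_takagiVdW hr).measurable
    (s := fun n => ((r : ℝ) ^ (n + 1))⁻¹) ?_ ?_
  · rw [tendsto_nhdsWithin_iff]
    refine ⟨?_, Filter.Eventually.of_forall fun n => by
      simp only [Set.mem_Ioi]; positivity⟩
    exact tendsto_inv_atTop_zero.comp
      ((tendsto_pow_atTop_atTop_of_one_lt hr1).comp (Filter.tendsto_add_atTop_nat 1))
  filter_upwards [ae_frequently_slope_eq_zero hr, ae_restrict_mem measurableSet_Ico] with x hx hx01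
  rw [Filter.frequently_atTop] at hx ⊢
  intro N
  -- Starting from `N + 1` rules out the empty sum at `m = 0`.
  obtain ⟨m, hmN, hm⟩ := hx (N + 1)
  obtain ⟨n, rfl⟩ : ∃ n, m = n + 1 := ⟨m - 1, by omega⟩
  refine ⟨n, by omega, takagiPartial r (n + 1) x, ?_, two_mul_occupationMeasure_le hr hx01 hm⟩
  rw [takagiVdW_eq_partial_add hr (n + 1) x, add_sub_cancel_left, abs_of_nonneg
    (mul_nonneg (by positivity) (takagiVdW_nonneg _ _))]
  exact mul_le_of_le_one_right (by positivity) (takagiVdW_le_one hr _)
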